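/- **Setting.** Let $Z$ be a measurable space of data points, let $\mathcal C$ be a measurable space of training configurations, and let parameters live in $\mathbb R^p$ with the Euclidean norm. A configuration $a$ has a feasible set $\Gamma_a\subseteq\mathbb R^p$, a preconditioner $P_a(\theta)$ (a linear map) and a per-sample update $g_a(\theta;z)\in\mathbb R^p$. With a common step size $\eta>0$, training on a distribution $\mu$ is the iteration $$\theta_{t+1}=\Phi_a(\theta_t;\mu)=\theta_t-\eta\,P_a(\theta_t)\,\mathbb E_\mu g_a(\theta_t;z).$$ For a loss $\ell$ write $R_\nu(\theta)=\mathbb E_\nu\,\ell(\theta;z)$. Let $\mathcal D_\tau$ ($n$ points), $\mathcal D_s$ ($k$ points) and $\mathcal D_{te}$ ($m$ points) be i.i.d. samples from probability measures $\mu_\tau,\mu_s,\nu$ respectively, with $1\le k\le n$ and $m\ge1$, and let $\hat\mu_\tau,\hat\mu_s,\hat\nu$ be their empirical distributions. $\mathcal D_{te}$ is independent of $(\mathcal D_\tau,\mathcal D_s)$. Let $\theta^{(s,a)}_T$ and $\theta^{(\tau,a)}_T$ be the parameters after $T$ steps under $a$ on $\hat\mu_s$ and $\hat\mu_\tau$,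 started from $\theta^{(s)}_0$ and $\theta^{(\tau)}_0$ (the same for all $a$), and put $\delta_0=\theta_0^{(s)}-\theta_0^{(\tau)}$. Let $\mathcal A\subseteq\mathcal C$ be a family of configurations and $r>0$. Define - $d_{\mathcal A}(a,a')=\sup_{\theta\in\Gamma_a\cap\Gamma_{a'}}\|P_a(\theta)\mathbb E_{\hat\mu_\tau}g_a(\theta;z)-P_{a'}(\theta)\mathbb E_{\hat\mu_\tau}g_{a'}(\theta;z)\|$; - $N=N(\mathcal A,d_{\mathcal A},r)$, the least number of closed $d_{\mathcal A}$-balls of radius $r$ with centres in $\mathcal A$ that cover $\mathcal A$, and $\mathcal H_{\rm cov}=\log N$ (both depend on the realised real data through $\hat\mu_\tau$); - $\Delta_a(\mu,\mu')=\sup_{\theta\in\Gamma_a}\|P_a(\theta)(\mathbb E_\mu g_a(\theta;z)-\mathbb E_{\mu'}g_a(\theta;z))\|$; - $\Delta_a^\star=\inf_{\mu}\Delta_a(\mu_\tau,\mu)$ over probability measures $\mu$ with at most $k$ atoms; - the matching excess $\gamma=\sup_{a\in\mathcal A}\big(\Delta_a(\mu_\tau,\mu_s)-\Delta_a^\star\big)_+$,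 which is $0$ when $\mu_s$ attains $\Delta_a^\star$ for every $a\in\mathcal A$; - $I(\mathcal D_s;\mathcal D_\tau)$, the mutual information. **Assumptions.** There are constants $\kappa,B_g,B_\ell,C_G\ge0$, $L_R,L_{\rm conf}>0$, $\rho\in(0,1)$ and a set $\Gamma\subseteq\bigcap_{a\in\mathcal A}\Gamma_a$ such that: 1. for $a\in\mathcal A$ and $\theta\in\Gamma_a$, $g_a(\theta;\cdot)$ is measurable, $\|g_a(\theta;z)\|\le B_g$ for all $z$, and $\|P_a(\theta)\|\le\kappa$; 2. for $\theta\in\Gamma$, $\ell(\theta;\cdot)$ is measurable and $|\ell(\theta;z)|\le B_\ell$ for all $z$; almost surely $R_{\hat\nu}$ is $L_R$-Lipschitz on $\Gamma$; 3. almost surely, for every $a\in\mathcal A$, both training trajectories stay in $\Gamma$ up to time $T$, and $\Phi_a(\cdot;\mu)$ is $\rho$-Lipschitz on $\Gamma$ for $\mu\in\{\hat\mu_\tau,\hat\mu_s\}$; 4. for every $a\in\mathcal A$ the class $\mathcal G_a=\{g_a(\theta;\cdot):\theta\in\Gamma\}$ is pointwise separable, with $\mathfrak R_k(\mathcal G_a)\le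 C_G/\sqrt k$ under $\mu_s$ and $\mathfrak R_n(\mathcal G_a)\le C_G/\sqrt n$ under $\mu_\tau$, where $\mathfrak R_N(\mathcal G_a)=\mathbb E\sup_{\theta\in\Gamma}\big\|\tfrac2N\sum_{i=1}^N\sigma_i g_a(\theta;z_i)\big\|$ with i.i.d. $z_i$ and independent uniform random signs $\sigma_i$; 5. almost surely $N(\mathcal A,d_{\mathcal A},r)<\infty$; 6. (Lipschitz transfer, uniform over draws) for almost every draw of the real data defining $d_{\mathcal A}$ and almost every further draw of $(\hat\mu_\tau,\hat\mu_s)$: $\|P_a(\theta)\mathbb E_\mu g_a(\theta;z)-P_{a'}(\theta)\mathbb E_\mu g_{a'}(\theta;z)\|\le L_{\rm conf}\,d_{\mathcal A}(a,a')$ for all $a,a'\in\mathcal A$, $\theta\in\Gamma$ and $\mu\in\{\hat\mu_\tau,\hat\mu_s\}$, where $\hat\mu_\tau,\hat\mu_s$ come from the further draw. **Theorem.** For every $\varepsilon\in(0,1)$ there are positive constants $K,A_1,A_2,K_{\rm cov},K_I$ depending only on $\eta,\kappa,\rho,L_R,B_g,B_\ell,C_G,L_{\rm conf},\varepsilon$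 such that, in every setting as above, the following holds. Put $$\epsilon_{\rm bound}=K\Big(\rho^T\|\delta_0\|+\sup_{a\in\mathcal A}\Delta_a^\star+\gamma+\tfrac1{\sqrt n}+\tfrac{\sqrt{\mathcal H_{\rm cov}}}{\sqrt m}+r\Big),\qquad C_{\rm cov}=K_{\rm cov}\sqrt{\mathcal H_{\rm cov}}.$$ If $\mathcal D_s$ and $\mathcal D_\tau$ are independent, then with probability at least $1-\varepsilon$: if $N(\mathcal A,d_{\mathcal A},r)\ge2$, then for every probability measure $\Pi$ on $\mathcal C$ supported on $\mathcal A$ $$\mathbb E_{a\sim\Pi}\big|R_\nu(\theta_T^{(s,a)})-R_\nu(\theta_T^{(\tau,a)})\big|\le\epsilon_{\rm bound}+A_1\frac{\mathcal H_{\rm cov}}k+A_2\sqrt{\frac{\mathcal H_{\rm cov}}k},$$ and $$\sup_{a\in\mathcal A}\big|R_\nu(\theta_T^{(s,a)})-R_\nu(\theta_T^{(\tau,a)})\big|\le\epsilon_{\rm bound}+\frac{C_{\rm cov}}{\sqrt k}.$$ If $\mathcal D_s$ may depend on $\mathcal D_\tau$ (arbitrary coupling of the two samples), the same holds with $K_I\sqrt{I(\mathcal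 D_s;\mathcal D_\tau)/k}$ added to the right-hand side of both bounds. -/

import Mathlib

open MeasureTheory ProbabilityTheory Filter Topology
open scoped ENNReal

universe u v w

/-- The Euclidean parameter space. -/
abbrev Param (p : ℕ) : Type := EuclideanSpace ℝ (Fin p)

/-- The data of a space `C` of training configurations acting on data points of type `Z`:
the common step size `η` and, for each configuration `a`, the preconditioner `P a θ`, the
per-sample update `g a θ z` and the feasible parameter set `feasible a`; together with the loss. -/
structure TrainingSetup (C Z : Type*) (p : ℕ) where
  η : ℝ
  P : C → Param p → (Param p →L[ℝ] Param p)
  g : C → Param p → Z → Param p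
  feasible : C → Set (Param p)
  loss : Param p → Z → ℝ

/-- The empirical distribution `(1/N) ∑ᵢ δ_{zᵢ}` of a data set. -/
noncomputable def empirical {Z : Type*} [MeasurableSpace Z] {N : ℕ} (z : Fin N → Z) : Measure Z :=
  (N : ℝ≥0∞)⁻¹ • ∑ i, Measure.dirac (z i)

/-- The class of `k`-prototype distributions: probability measures carried by at most `k` atoms. -/
def prototypes (Z : Type*) [MeasurableSpace Z] (k : ℕ) : Set (Measure Z) :=
  {μ | ∃ (z : Fin k → Z) (w : Fin k → ℝ≥0∞), ∑ j, w j = 1 ∧ μ = ∑ j, w j • Measure.dirac (z j)}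

/-- The covering number of `A` at radius `r` for a distance function `d`: the least number of
(closed) `d`-balls of radius `r` with centres in `A` that cover `A`; it is `⊤` if no finite
number suffices. -/
noncomputable def coveringNumber {C : Type*} (A : Set C) (d : C → C → ℝ≥0∞) (r : ℝ) : ℕ∞ :=
  ⨅ (F : Finset C) (_ : (F : Set C) ⊆ A) (_ : ∀ a ∈ A, ∃ b ∈ F, d a b ≤ ENNReal.ofReal r),
    (F.card : ℕ∞)

/-- Mutual information (in nats) of two random variables: the Kullback-Leibler divergence of the
joint law from the product of the marginal laws. -/
noncomputable def mutualInformation {Ω X Y : Type*} [MeasurableSpace Ω] [MeasurableSpace X]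
    [MeasurableSpace Y] (U : Ω → X) (V : Ω → Y) (Pr : Measure Ω) : ℝ≥0∞ :=
  InformationTheory.klDiv (Pr.map (fun ω => (U ω, V ω))) ((Pr.map U).prod (Pr.map V))

namespace TrainingSetup

variable {C Z : Type*} [MeasurableSpace Z] {p : ℕ}

/-- The update field `P_a(θ) 𝔼_μ g_a(θ; z)`. -/
noncomputable def field (S : TrainingSetup C Z p) (a : C) (μ : Measure Z) (θ : Param p) : Param p :=
  S.P a θ (∫ z, S.g a θ z ∂μ)

/-- One training step `Φ_a(θ; μ) = θ - η P_a(θ) 𝔼_μ g_a(θ; z)`. -/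
noncomputable def step (S : TrainingSetup C Z p) (a : C) (μ : Measure Z) (θ : Param p) : Param p :=
  θ - S.η • S.field a μ θ

/-- The parameter after `t` training steps under configuration `a` on `μ`, started from `θ₀`. -/
noncomputable def iter (S : TrainingSetup C Z p) (a : C) (μ : Measure Z) (θ₀ : Param p) (t : ℕ) :
    Param p :=
  (S.step a μ)^[t] θ₀

/-- The risk `𝔼_ν loss(θ; z)`. -/
noncomputable def risk (S : TrainingSetup C Z p) (ν : Measure Z) (θ : Param p) : ℝ :=
  ∫ z, S.loss θ z ∂ν

/-- The configuration distance anchored at the data distribution `μ`. -/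
noncomputable def configDist (S : TrainingSetup C Z p) (μ : Measure Z) (a a' : C) : ℝ≥0∞ :=
  ⨆ θ ∈ S.feasible a ∩ S.feasible a', ‖S.field a μ θ - S.field a' μ θ‖ₑ

/-- The coverage complexity `log N(A, d_A, r)`, with `d_A` anchored at `μ`. -/
noncomputable def Hcov (S : TrainingSetup C Z p) (A : Set C) (μ : Measure Z) (r : ℝ) : ℝ :=
  Real.log ((coveringNumber A (S.configDist μ) r).toNat : ℝ)

/-- The matching discrepancy `Δ_a(μ, ν)`. -/
noncomputable def discrepancy (S : TrainingSetup C Z p) (a : C) (μ ν : Measure Z) : ℝ≥0∞ :=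
  ⨆ θ ∈ S.feasible a, ‖S.P a θ ((∫ z, S.g a θ z ∂μ) - ∫ z, S.g a θ z ∂ν)‖ₑ

/-- The intrinsic error `Δ_a^⋆`: the best matching of `μ` by `k` prototypes under `a`. -/
noncomputable def intrinsicError (S : TrainingSetup C Z p) (a : C) (μ : Measure Z) (k : ℕ) :
    ℝ≥0∞ :=
  ⨅ ν ∈ prototypes Z k, S.discrepancy a μ ν

/-- The worst excess, over the family `A`, of the discrepancy `Δ_a(μ, μs)` over the intrinsic
error. It vanishes if `μs` attains the intrinsic error for every `a ∈ A`. -/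
noncomputable def matchingExcess (S : TrainingSetup C Z p) (A : Set C) (μ μs : Measure Z) (k : ℕ) :
    ℝ≥0∞ :=
  ⨆ a ∈ A, (S.discrepancy a μ μs - S.intrinsicError a μ k)

/-- The Rademacher complexity at sample size `N`, under the law `μ`, of the vector-valued class
`{z ↦ g_a(θ; z) : θ ∈ Γ}`:
`𝔼_{z ∼ μ^N} 𝔼_σ sup_{θ ∈ Γ} sup_{‖v‖ ≤ 1} (2/N) ∑ᵢ σᵢ ⟨v, g_a(θ; zᵢ)⟩`;
the supremum over `v` is the Euclidean norm. -/
noncomputable def rademacher (S : TrainingSetup C Z p) (Γ : Set (Param p)) (a : C) (μ : Measure Z)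
    (N : ℕ) : ℝ≥0∞ :=
  ∫⁻ z : Fin N → Z, (2 ^ N : ℝ≥0∞)⁻¹ * ∑ σ : Fin N → ℤˣ,
      ⨆ θ ∈ Γ, ‖(2 / (N : ℝ)) • ∑ i, (((σ i : ℤ) : ℝ) • S.g a θ (z i))‖ₑ
    ∂(Measure.pi fun _ => μ)

/-- Pointwise separability of the class `{z ↦ g_a(θ; z) : θ ∈ Γ}`. -/
def PointwiseSeparable (S : TrainingSetup C Z p) (Γ : Set (Param p)) (a : C) : Prop :=
  ∃ Γ₀ ⊆ Γ, Γ₀.Countable ∧ ∀ θ ∈ Γ, ∃ u : ℕ → Param p, (∀ j, u j ∈ Γ₀) ∧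
    ∀ z, Tendsto (fun j => S.g a (u j) z) atTop (𝓝 (S.g a θ z))

/-- The absolute gap `|R_ν(θ_T^{(s,a)}) - R_ν(θ_T^{(τ,a)})|` between training on `μs` from `θs`
and training on `μτ` from `θτ`. -/
noncomputable def riskGap (S : TrainingSetup C Z p) (ν μs μτ : Measure Z) (θs θτ : Param p) (T : ℕ)
    (a : C) : ℝ :=
  |S.risk ν (S.iter a μs θs T) - S.risk ν (S.iter a μτ θτ T)|

end TrainingSetup

/-! The argument is stability of contracting iterations plus uniform concentration over a finite
cover of configurations. Contraction sums the per-step differences of the update fields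
geometrically, so the final parameters differ by at most `ρ ^ T * ‖θs - θτ‖` plus `η / (1 - ρ)`
times the largest field difference on `Γ` (`norm_iter_sub_iter_le`). That difference splits into a
population discrepancy and two sampling deviations (`norm_field_sub_field_le`). The deviations are
controlled by symmetrization and McDiarmid (`exists_bad_event`), and the population risk is
Lipschitz because it is the mean of the empirical test risks (`abs_risk_sub_risk_le`).

Uniformity in the configuration comes from a union bound over a cover. The natural cover depends on
the same data as the deviations. It is therefore replaced by a deterministic cover `F`, taken at an
outcome where the covering number is minimal. Transfer between draws makes `F` valid almost surely,
and minimality gives `F.card ≤ N ω`, so the price of the union bound is at most the realised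
coverage complexity.

Only the marginal laws of the two training samples enter the union bound, so one exceptional event
serves every coupling. Outside it the estimate holds for all configurations at once, hence after
averaging over any prior. -/

/-! ### Bounded differences and sub-Gaussian concentration. -/

/-- **McDiarmid's inequality**, in its sub-Gaussian form: a bounded measurable function of `n`
i.i.d. variables that changes by at most `c` when one variable changes is sub-Gaussian with
parameter `n * c ^ 2`. -/
theorem hasSubgaussianMGF_of_boundedDifferences {Z : Type*} [MeasurableSpace Z] (μ : Measure Z)
    [IsProbabilityMeasure μ] (c : NNReal) (M : ℝ) :
    ∀ (n : ℕ) (f : (Fin n → Z) → ℝ), Measurable f → (∀ z, |f z| ≤ M) →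
      (∀ i z x, |f (Function.update z i x) - f z| ≤ c) →
      HasSubgaussianMGF (fun z => f z - ∫ y, f y ∂(Measure.pi fun _ => μ)) (n * c ^ 2)
        (Measure.pi fun _ => μ) := by
  intro n
  induction n with
  | zero =>
    intro f _ _ _
    have h : ∀ z, f z = f default := fun z => congrArg f (Subsingleton.elim _ _)
    simp [h]
  | succ n ih =>
    intro f hf hM hc
    set π : Measure (Fin n → Z) := Measure.pi fun _ => μ
    -- Split off one coordinate `x`. With `h x` the average over the others, `F - 𝔼 F = (F (x, ·) -
    -- h x) + (h x - 𝔼 h)`: induction handles the first term for each fixed `x`, Hoeffding's lemma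
    -- the second, and the parameters add.
    let e := MeasurableEquiv.piFinSuccAbove (fun _ : Fin (n + 1) => Z) 0
    have he : MeasurePreserving e (Measure.pi fun _ => μ) (μ.prod π) :=
      measurePreserving_piFinSuccAbove (fun _ => μ) 0
    let F : Z × (Fin n → Z) → ℝ := fun q => f (e.symm q)
    have hF : Measurable F := hf.comp e.symm.measurable
    have hFM : ∀ q, |F q| ≤ M := fun q => hM _
    have hFint : Integrable F (μ.prod π) :=
      Integrable.of_bound hF.aestronglyMeasurable M (ae_of_all _ hFM)
    have hFx : ∀ x, Measurable fun w => F (x, w) := fun x => hF.comp measurable_prodMk_left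
    have hFxint : ∀ x, Integrable (fun w => F (x, w)) π := fun x =>
      Integrable.of_bound (hFx x).aestronglyMeasurable M (ae_of_all _ fun w => hFM _)
    have hcons : ∀ x w, F (x, w) = f (Fin.cons x w) := fun x w => by
      simp [F, e, Fin.insertNthEquiv]
    let h : Z → ℝ := fun x => ∫ w, F (x, w) ∂π
    have hh : Measurable h := hF.stronglyMeasurable.integral_prod_right'.measurable
    have hdiff : ∀ x y, |h x - h y| ≤ c := by
      intro x y
      have : h x - h y = ∫ w, (F (x, w) - F (y, w)) ∂π :=
        (integral_sub (hFxint x) (hFxint y)).symm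
      rw [this, ← Real.norm_eq_abs]
      refine (norm_integral_le_of_norm_le_const (C := c) (ae_of_all _ fun w => ?_)).trans (by simp)
      have := hc 0 (Fin.cons y w) x
      rw [Fin.update_cons_zero] at this
      simpa [hcons] using this
    have hmean : ∫ y, f y ∂(Measure.pi fun _ => μ) = ∫ x, h x ∂μ := by
      rw [← integral_prod F hFint, ← he.integral_comp' F]
      simp [F]
    obtain ⟨x₀⟩ : Nonempty Z := nonempty_of_isProbabilityMeasure μ
    have hsubh : HasSubgaussianMGF (fun x => h x - ∫ y, h y ∂μ) (c ^ 2) μ := by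
      -- Centring at an arbitrary `h x₀` gives an interval of length `2 * c`, hence the parameter `c
      -- ^ 2`; the sharp `c ^ 2 / 4` is not needed.
      have := hasSubgaussianMGF_of_mem_Icc (μ := μ) (X := h) (a := h x₀ - c) (b := h x₀ + c)
        hh.aemeasurable (ae_of_all _ fun x => by
          have := abs_le.1 (hdiff x x₀)
          exact ⟨by linarith, by linarith⟩)
      convert this using 1
      rw [show h x₀ + c - (h x₀ - c) = 2 * (c : ℝ) by ring]
      ext
      simp
    have hsubF : ∀ x, HasSubgaussianMGF (fun w => F (x, w) - h x) (n * c ^ 2) π := by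
      intro x
      refine ih (fun w => F (x, w)) (hFx x) (fun w => hFM _) fun i w y => ?_
      have := hc i.succ (Fin.cons x w) y
      rw [← Fin.cons_update] at this
      simpa only [hcons] using this
    have hprod : HasSubgaussianMGF (fun q => F q - ∫ x, h x ∂μ) (((n + 1 : ℕ) : NNReal) * c ^ 2)
        (μ.prod π) := by
      have hint : ∀ t, Integrable (fun q => Real.exp (t * (F q - ∫ x, h x ∂μ))) (μ.prod π) :=
        fun t => integrable_exp_mul_of_mem_Icc (a := -M - ∫ x, h x ∂μ) (b := M - ∫ x, h x ∂μ)
          (hF.sub_const _).aemeasurable (ae_of_all _ fun q => by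
            have := abs_le.1 (hFM q)
            exact ⟨by linarith, by linarith⟩)
      refine ⟨hint, fun t => ?_⟩
      have hsplit : ∀ x, ∫ w, Real.exp (t * (F (x, w) - ∫ x, h x ∂μ)) ∂π
          = mgf (fun w => F (x, w) - h x) π t * Real.exp (t * (h x - ∫ y, h y ∂μ)) := by
        intro x
        rw [mgf, ← integral_mul_const]
        refine integral_congr_ae (ae_of_all _ fun w => ?_)
        simp only
        rw [← Real.exp_add]
        ring_nf
      rw [mgf, integral_prod _ (hint t)]
      calc ∫ x, ∫ w, Real.exp (t * (F (x, w) - ∫ x, h x ∂μ)) ∂π ∂μ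
          ≤ ∫ x, Real.exp (((n * c ^ 2 : NNReal) : ℝ) * t ^ 2 / 2)
              * Real.exp (t * (h x - ∫ y, h y ∂μ)) ∂μ := by
            refine integral_mono (hint t).integral_prod_left
              ((hsubh.integrable_exp_mul t).const_mul _) fun x => ?_
            simp only [hsplit x]
            exact mul_le_mul_of_nonneg_right ((hsubF x).mgf_le t) (Real.exp_pos _).le
        _ = Real.exp (((n * c ^ 2 : NNReal) : ℝ) * t ^ 2 / 2)
              * mgf (fun x => h x - ∫ y, h y ∂μ) μ t := integral_const_mul _ _
        _ ≤ Real.exp (((n * c ^ 2 : NNReal) : ℝ) * t ^ 2 / 2)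
              * Real.exp (((c ^ 2 : NNReal) : ℝ) * t ^ 2 / 2) :=
            mul_le_mul_of_nonneg_left (hsubh.mgf_le t) (Real.exp_pos _).le
        _ = _ := by
            rw [← Real.exp_add]
            push_cast
            ring_nf
    rw [hmean]
    rw [← he.map_eq] at hprod
    have := hprod.of_map he.measurable.aemeasurable
    convert this using 1
    ext z
    simp [F]

/-! ### Symmetrization and uniform deviation of empirical means. -/

section Symmetrization

variable {Z E ι : Type*} [MeasurableSpace Z] [NormedAddCommGroup E] [NormedSpace ℝ E]

/-- The uniform deviation of the empirical means of a family `g` from its means under `μ`. -/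
noncomputable def uniformDeviation (g : ι → Z → E) (μ : Measure Z) {N : ℕ} (z : Fin N → Z) :
    ℝ≥0∞ :=
  ⨆ i, ‖(N : ℝ)⁻¹ • ∑ j, g i (z j) - ∫ y, g i y ∂μ‖ₑ

/-- The supremum over a family `g` of the norms of the empirical means with signs `σ`,
multiplied by `2`. -/
noncomputable def signedSup (g : ι → Z → E) {N : ℕ} (σ : Fin N → ℤˣ) (z : Fin N → Z) : ℝ≥0∞ :=
  ⨆ i, ‖(2 / (N : ℝ)) • ∑ j, (((σ j : ℤ) : ℝ) • g i (z j))‖ₑ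

variable {g : ι → Z → E} {N : ℕ}

theorem uniformDeviation_le {B : ℝ} (hB : ∀ i z, ‖g i z‖ ≤ B) (hN : 0 < N)
    (μ : Measure Z) [IsProbabilityMeasure μ] (z : Fin N → Z) :
    uniformDeviation g μ z ≤ ENNReal.ofReal (2 * B) := by
  refine iSup_le fun i => ?_
  rw [← ofReal_norm]
  refine ENNReal.ofReal_le_ofReal ((norm_sub_le _ _).trans ?_)
  have h1 : ‖(N : ℝ)⁻¹ • ∑ j, g i (z j)‖ ≤ B := by
    rw [norm_smul, norm_inv, Real.norm_natCast, inv_mul_le_iff₀ (by positivity)]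
    simpa using norm_sum_le_of_le Finset.univ fun j _ => hB i (z j)
  have h2 : ‖∫ y, g i y ∂μ‖ ≤ B := by
    simpa using norm_integral_le_of_norm_le_const (μ := μ) (ae_of_all _ (hB i))
  linarith

/-- Only one summand changes, by at most `2 * B` before division by `N`. This supplies the constant
for McDiarmid's inequality. -/
theorem uniformDeviation_update_le {B : ℝ} (hB : ∀ i z, ‖g i z‖ ≤ B) (μ : Measure Z)
    (z : Fin N → Z) (l : Fin N) (x : Z) :
    uniformDeviation g μ (Function.update z l x)
      ≤ uniformDeviation g μ z + ENNReal.ofReal (2 * B / N) := by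
  refine iSup_le fun i => ?_
  have hsum : ∑ j, g i (Function.update z l x j) = ∑ j, g i (z j) + (g i x - g i (z l)) := by
    rw [← sub_eq_iff_eq_add', ← Finset.sum_sub_distrib, Finset.sum_eq_single l]
    · simp
    · intro j _ hj
      simp [hj]
    · simp
  rw [hsum, smul_add, add_sub_right_comm]
  refine (enorm_add_le _ _).trans (add_le_add
    (le_iSup (fun i => ‖(N : ℝ)⁻¹ • ∑ j, g i (z j) - ∫ y, g i y ∂μ‖ₑ) i) ?_)
  rw [← ofReal_norm, norm_smul, norm_inv, Real.norm_natCast, div_eq_inv_mul]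
  refine ENNReal.ofReal_le_ofReal (mul_le_mul_of_nonneg_left ?_ (by positivity))
  exact (norm_sub_le _ _).trans (by linarith [hB i x, hB i (z l)])

variable [Countable ι] [SecondCountableTopology E] [MeasurableSpace E] [BorelSpace E]

theorem measurable_uniformDeviation (hg : ∀ i, Measurable (g i)) (μ : Measure Z) :
    Measurable (uniformDeviation g μ : (Fin N → Z) → ℝ≥0∞) := by
  refine Measurable.iSup fun i => Measurable.enorm (Measurable.sub_const (Measurable.const_smul ?_ _) _)
  exact Finset.measurable_sum _ fun j _ => (hg i).comp (measurable_pi_apply j)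

theorem measurable_signedSup (hg : ∀ i, Measurable (g i)) (σ : Fin N → ℤˣ) :
    Measurable (signedSup g σ) := by
  refine Measurable.iSup fun i => Measurable.enorm (Measurable.const_smul ?_ _)
  exact Finset.measurable_sum _ fun j _ =>
    ((hg i).comp (measurable_pi_apply j)).const_smul _

omit [Countable ι] in
/-- Comparison with an independent ghost sample. -/
theorem uniformDeviation_le_lintegral_ghost [CompleteSpace E] (hg : ∀ i, Measurable (g i)) {B : ℝ}
    (hB : ∀ i z, ‖g i z‖ ≤ B) (hN : 0 < N) (μ : Measure Z) [IsProbabilityMeasure μ]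
    (z : Fin N → Z) :
    uniformDeviation g μ z ≤ ∫⁻ y : Fin N → Z,
      (⨆ i, ‖(N : ℝ)⁻¹ • ∑ j, (g i (z j) - g i (y j))‖ₑ) ∂(Measure.pi fun _ => μ) := by
  refine iSup_le fun i => ?_
  have hint : ∀ j : Fin N, Integrable (fun y : Fin N → Z => g i (y j)) (Measure.pi fun _ => μ) :=
    fun j => Integrable.of_bound ((hg i).comp (measurable_pi_apply j)).aestronglyMeasurable B
      (ae_of_all _ fun y => hB _ _)
  have hmean : ∀ j : Fin N, ∫ y : Fin N → Z, g i (y j) ∂(Measure.pi fun _ => μ)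
      = ∫ y, g i y ∂μ := fun j => by
    have := measurePreserving_eval (fun _ : Fin N => μ) j
    conv_rhs => rw [← this.map_eq]
    rw [integral_map this.measurable.aemeasurable (hg i).aestronglyMeasurable]
  have hN' : (N : ℝ) ≠ 0 := by positivity
  -- The population mean is the expected empirical mean of the ghost sample, so the norm and then
  -- the supremum can be moved inside the integral.
  have : (N : ℝ)⁻¹ • ∑ j, g i (z j) - ∫ y, g i y ∂μ
      = ∫ y : Fin N → Z, (N : ℝ)⁻¹ • ∑ j, (g i (z j) - g i (y j)) ∂(Measure.pi fun _ => μ) := by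
    rw [integral_smul, integral_finsetSum (f := fun j (y : Fin N → Z) => g i (z j) - g i (y j)) _
      fun j _ => (integrable_const _).sub (hint j)]
    simp_rw [integral_sub (integrable_const _) (hint _), hmean, Finset.sum_sub_distrib, smul_sub]
    simp [← Nat.cast_smul_eq_nsmul ℝ, smul_smul, hN']
  rw [this]
  exact (enorm_integral_le_lintegral_enorm _).trans
    (lintegral_mono fun y => le_iSup (fun i => ‖(N : ℝ)⁻¹ • ∑ j, (g i (z j) - g i (y j))‖ₑ) i)

/-- Exchanging `z j` and `y j` where `σ j = -1` preserves the product law and flips the sign of that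
difference. The triangle inequality then separates the two samples, each contributing half of
`signedSup` because of its factor `2 / N`. This works for every fixed `σ`. -/
theorem lintegral_ghost_le_lintegral_signedSup (hg : ∀ i, Measurable (g i)) (μ : Measure Z)
    [IsProbabilityMeasure μ] (σ : Fin N → ℤˣ) :
    ∫⁻ z : Fin N → Z, ∫⁻ y : Fin N → Z,
      (⨆ i, ‖(N : ℝ)⁻¹ • ∑ j, (g i (z j) - g i (y j))‖ₑ) ∂(Measure.pi fun _ => μ)
        ∂(Measure.pi fun _ => μ)
      ≤ ∫⁻ z, signedSup g σ z ∂(Measure.pi fun _ => μ) := by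
  set D : (Fin N → Z) × (Fin N → Z) → ℝ≥0∞ := fun q =>
    ⨆ i, ‖(N : ℝ)⁻¹ • ∑ j, (g i (q.1 j) - g i (q.2 j))‖ₑ with hD
  have hDm : Measurable D := by
    refine Measurable.iSup fun i => Measurable.enorm (Measurable.const_smul ?_ _)
    exact Finset.measurable_sum _ fun j _ =>
      ((hg i).comp ((measurable_pi_apply j).comp measurable_fst)).sub
        ((hg i).comp ((measurable_pi_apply j).comp measurable_snd))
  have hpair := measurePreserving_arrowProdEquivProdArrow Z Z (Fin N) (fun _ => μ) (fun _ => μ)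
  have hfst : MeasurePreserving (fun (w : Fin N → Z × Z) j => (w j).1)
      (Measure.pi fun _ => μ.prod μ) (Measure.pi fun _ => μ) :=
    measurePreserving_pi _ _ fun _ => measurePreserving_fst
  have hsnd : MeasurePreserving (fun (w : Fin N → Z × Z) j => (w j).2)
      (Measure.pi fun _ => μ.prod μ) (Measure.pi fun _ => μ) :=
    measurePreserving_pi _ _ fun _ => measurePreserving_snd
  have hswap : MeasurePreserving
      (fun (w : Fin N → Z × Z) j => (if σ j = 1 then id else Prod.swap) (w j))
      (Measure.pi fun _ => μ.prod μ) (Measure.pi fun _ => μ.prod μ) :=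
    measurePreserving_pi _ _ fun j => by
      split_ifs
      · exact MeasurePreserving.id _
      · exact Measure.measurePreserving_swap
  calc ∫⁻ z, ∫⁻ y, D (z, y) ∂(Measure.pi fun _ => μ) ∂(Measure.pi fun _ => μ)
      = ∫⁻ q, D q ∂((Measure.pi fun _ => μ).prod (Measure.pi fun _ => μ)) :=
        (lintegral_prod _ hDm.aemeasurable).symm
    _ = ∫⁻ w : Fin N → Z × Z, D (fun j => (w j).1, fun j => (w j).2)
          ∂(Measure.pi fun _ => μ.prod μ) := (hpair.lintegral_comp hDm).symm
    _ = ∫⁻ w : Fin N → Z × Z, D (fun j => ((if σ j = 1 then id else Prod.swap) (w j)).1,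
          fun j => ((if σ j = 1 then id else Prod.swap) (w j)).2)
          ∂(Measure.pi fun _ => μ.prod μ) :=
        (hswap.lintegral_comp (hDm.comp hpair.measurable)).symm
    _ ≤ ∫⁻ w : Fin N → Z × Z, (2⁻¹ * signedSup g σ (fun j => (w j).1)
          + 2⁻¹ * signedSup g σ (fun j => (w j).2)) ∂(Measure.pi fun _ => μ.prod μ) := by
        refine lintegral_mono fun w => iSup_le fun i => ?_
        have hterm : (N : ℝ)⁻¹ • ∑ j, (g i ((if σ j = 1 then id else Prod.swap) (w j)).1
              - g i ((if σ j = 1 then id else Prod.swap) (w j)).2)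
            = (2⁻¹ : ℝ) • ((2 / (N : ℝ)) • ∑ j, (((σ j : ℤ) : ℝ) • g i (w j).1))
              - (2⁻¹ : ℝ) • ((2 / (N : ℝ)) • ∑ j, (((σ j : ℤ) : ℝ) • g i (w j).2)) := by
          rw [smul_smul, smul_smul, show (2⁻¹ : ℝ) * (2 / N) = (N : ℝ)⁻¹ by ring, ← smul_sub,
            ← Finset.sum_sub_distrib]
          congr 1
          refine Finset.sum_congr rfl fun j _ => ?_
          rcases Int.units_eq_one_or (σ j) with h | h
          · simp [h]
          · simp [h, show (-1 : ℤˣ) ≠ 1 by decide]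
            abel
        simp only
        rw [hterm]
        refine (enorm_sub_le).trans ?_
        have h2 : ‖(2⁻¹ : ℝ)‖ₑ = 2⁻¹ := by
          rw [enorm_inv two_ne_zero]
          simp [enorm_eq_nnnorm]
        rw [enorm_smul, enorm_smul (2⁻¹ : ℝ), h2]
        gcongr
        · exact le_iSup (fun i => ‖(2 / (N : ℝ)) • ∑ j, (((σ j : ℤ) : ℝ) • g i (w j).1)‖ₑ) i
        · exact le_iSup (fun i => ‖(2 / (N : ℝ)) • ∑ j, (((σ j : ℤ) : ℝ) • g i (w j).2)‖ₑ) i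
    _ = ∫⁻ z, signedSup g σ z ∂(Measure.pi fun _ => μ) := by
        have hm := measurable_signedSup hg σ
        have h1 : Measurable fun w : Fin N → Z × Z => signedSup g σ (fun j => (w j).1) :=
          hm.comp hfst.measurable
        have h2 : Measurable fun w : Fin N → Z × Z => signedSup g σ (fun j => (w j).2) :=
          hm.comp hsnd.measurable
        rw [lintegral_add_left (h1.const_mul _), lintegral_const_mul _ h1,
          lintegral_const_mul _ h2, hfst.lintegral_comp hm,
          hsnd.lintegral_comp hm, ← add_mul, ENNReal.inv_two_add_inv_two, one_mul]

/-- **Symmetrization**: the expected uniform deviation is at most the Rademacher complexity. -/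
theorem lintegral_uniformDeviation_le [CompleteSpace E] (hg : ∀ i, Measurable (g i)) {B : ℝ}
    (hB : ∀ i z, ‖g i z‖ ≤ B) (hN : 0 < N) (μ : Measure Z) [IsProbabilityMeasure μ] :
    ∫⁻ z : Fin N → Z, uniformDeviation g μ z ∂(Measure.pi fun _ => μ)
      ≤ ∫⁻ z : Fin N → Z, (2 ^ N : ℝ≥0∞)⁻¹ * ∑ σ : Fin N → ℤˣ, signedSup g σ z
          ∂(Measure.pi fun _ => μ) := by
  -- The same bound holds for each of the `2 ^ N` sign patterns, so it holds for their average.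
  have h := fun σ : Fin N → ℤˣ =>
    (lintegral_mono fun z => uniformDeviation_le_lintegral_ghost hg hB hN μ z).trans
      (lintegral_ghost_le_lintegral_signedSup hg μ σ)
  have hm := fun σ : Fin N → ℤˣ => measurable_signedSup hg σ
  rw [lintegral_const_mul _ (Finset.measurable_sum _ fun σ _ => hm σ),
    lintegral_finsetSum _ fun σ _ => hm σ]
  have hcard : (Finset.univ : Finset (Fin N → ℤˣ)).card = 2 ^ N := by
    simp [Fintype.card_units_int]
  have hsum := Finset.card_nsmul_le_sum Finset.univ _ _ fun σ _ => h σ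
  rw [hcard, nsmul_eq_mul] at hsum
  calc _ = (2 ^ N : ℝ≥0∞)⁻¹ * ((2 ^ N : ℝ≥0∞)
            * ∫⁻ z : Fin N → Z, uniformDeviation g μ z ∂(Measure.pi fun _ => μ)) := by
          rw [← mul_assoc, ENNReal.inv_mul_cancel (by simp) (by simp), one_mul]
    _ ≤ _ := by
          gcongr
          simpa using hsum

/-- Concentration of the uniform deviation around a bound `R` of the Rademacher complexity. -/
theorem measure_uniformDeviation_gt_le [CompleteSpace E] (hg : ∀ i, Measurable (g i)) {B : ℝ}
    (hB0 : 0 < B) (hB : ∀ i z, ‖g i z‖ ≤ B) (hN : 0 < N) (μ : Measure Z) [IsProbabilityMeasure μ]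
    {R s : ℝ} (hR : 0 ≤ R) (hs : 0 ≤ s)
    (hrad : ∫⁻ z : Fin N → Z, (2 ^ N : ℝ≥0∞)⁻¹ * ∑ σ : Fin N → ℤˣ, signedSup g σ z
      ∂(Measure.pi fun _ => μ) ≤ ENNReal.ofReal R) :
    (Measure.pi fun _ : Fin N => μ) {z | ENNReal.ofReal (R + s) < uniformDeviation g μ z}
      ≤ ENNReal.ofReal (Real.exp (-(s ^ 2 * N / (8 * B ^ 2)))) := by
  have hdev := measurable_uniformDeviation (N := N) hg μ
  have hle := uniformDeviation_le hB hN μ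
  have hfin : ∀ z : Fin N → Z, uniformDeviation g μ z ≠ ⊤ := fun z =>
    ne_top_of_le_ne_top ENNReal.ofReal_ne_top (hle z)
  have hN' : (0 : ℝ) < N := by positivity
  have hupd : ∀ (z : Fin N → Z) l x, (uniformDeviation g μ (Function.update z l x)).toReal
      ≤ (uniformDeviation g μ z).toReal + 2 * B / N := fun z l x => by
    have := ENNReal.toReal_mono (by finiteness [hfin z]) (uniformDeviation_update_le hB μ z l x)
    rwa [ENNReal.toReal_add (hfin z) ENNReal.ofReal_ne_top,
      ENNReal.toReal_ofReal (by positivity)] at this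
  -- With `c = 2 * B / N` the parameter `N * c ^ 2` is `4 * B ^ 2 / N`, whence the `8 * B ^ 2` in
  -- the tail exponent.
  obtain ⟨c, hc⟩ : ∃ c : NNReal, (c : ℝ) = 2 * B / N := ⟨⟨2 * B / N, by positivity⟩, rfl⟩
  have hsub := hasSubgaussianMGF_of_boundedDifferences μ c (2 * B) N
    (fun z => (uniformDeviation g μ z).toReal) hdev.ennreal_toReal
    (fun z => by
      rw [abs_of_nonneg ENNReal.toReal_nonneg]
      exact ENNReal.toReal_le_of_le_ofReal (by positivity) (hle z))
    (fun l z x => by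
      have h1 := hupd z l x
      -- Undoing the update gives the reverse inequality.
      have h2 := hupd (Function.update z l x) l (z l)
      rw [Function.update_idem, Function.update_eq_self] at h2
      rw [abs_le]
      constructor <;> linarith)
  have hmean : ∫ z : Fin N → Z, (uniformDeviation g μ z).toReal ∂(Measure.pi fun _ => μ) ≤ R := by
    rw [integral_toReal hdev.aemeasurable (ae_of_all _ fun z => (hfin z).lt_top)]
    exact ENNReal.toReal_le_of_le_ofReal hR ((lintegral_uniformDeviation_le hg hB hN μ).trans hrad)
  have htail := hsub.measure_ge_le hs
  have hexp : -s ^ 2 / (2 * ((N * c ^ 2 : NNReal) : ℝ))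
      = -(s ^ 2 * N / (8 * B ^ 2)) := by
    push_cast
    rw [hc]
    field_simp
    ring
  rw [hexp] at htail
  refine (measure_mono fun z hz => ?_).trans
    ((ENNReal.le_ofReal_iff_toReal_le (measure_ne_top _ _) (Real.exp_pos _).le).2 htail)
  have := (ENNReal.ofReal_lt_iff_lt_toReal (by positivity) (hfin z)).1 hz
  simp only [Set.mem_ofPred_eq]
  linarith

end Symmetrization

/-! ### Empirical integrals and finite covers. -/

theorem integral_empirical {Z E : Type*} [MeasurableSpace Z] [NormedAddCommGroup E]
    [NormedSpace ℝ E] [CompleteSpace E] {f : Z → E} (hf : StronglyMeasurable f) {N : ℕ}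
    (z : Fin N → Z) : ∫ y, f y ∂(empirical z) = (N : ℝ)⁻¹ • ∑ j, f (z j) := by
  rw [empirical, integral_smul_measure, integral_finsetSum_measure fun j _ => ?_]
  · simp [integral_dirac' _ _ hf]
  · exact ⟨hf.aestronglyMeasurable, by
      simp [HasFiniteIntegral, lintegral_dirac' _ hf.enorm]⟩

/-- A finite covering number is attained by a finite cover. -/
theorem exists_cover_of_coveringNumber_ne_top {C : Type*} {A : Set C} {d : C → C → ℝ≥0∞} {r : ℝ}
    (h : coveringNumber A d r ≠ ⊤) :
    ∃ F : Finset C, (F : Set C) ⊆ A ∧ (∀ a ∈ A, ∃ b ∈ F, d a b ≤ ENNReal.ofReal r) ∧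
      (F.card : ℕ∞) ≤ coveringNumber A d r := by
  have hlt : coveringNumber A d r < coveringNumber A d r + 1 := ENat.lt_add_one_iff h |>.2 le_rfl
  conv_lhs at hlt => rw [coveringNumber]
  simp only [iInf_lt_iff] at hlt
  obtain ⟨F, hFA, hF, hcard⟩ := hlt
  exact ⟨F, hFA, hF, (ENat.lt_add_one_iff h).1 hcard⟩

/-! ### Stability of trajectories and deviation of the update fields. -/

namespace TrainingSetup

variable {C Z : Type*} [MeasurableSpace Z] {p : ℕ} (S : TrainingSetup C Z p)

/-- Truncated subtraction satisfies `x ≤ y + (x - y)` even for infinite values; each summand is then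
bounded by its supremum over `A`. -/
theorem discrepancy_le_intrinsicError_add_matchingExcess {A : Set C} {b : C} (hb : b ∈ A)
    (μ μs : Measure Z) (k : ℕ) :
    S.discrepancy b μ μs
      ≤ (⨆ a ∈ A, S.intrinsicError a μ k) + S.matchingExcess A μ μs k :=
  le_add_tsub.trans (add_le_add (le_iSup₂ (f := fun a (_ : a ∈ A) => S.intrinsicError a μ k) b hb)
    (le_iSup₂ (f := fun a (_ : a ∈ A) => S.discrepancy a μ μs - S.intrinsicError a μ k) b hb))

/-- The distance of two contracting trajectories whose update fields differ by at most `D`. -/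
theorem norm_iter_sub_iter_le {Γ : Set (Param p)} {a : C} {μs μτ : Measure Z} {θs θτ : Param p}
    {T : ℕ} {ρ D : ℝ} (hη : 0 ≤ S.η) (hρ0 : 0 < ρ) (hρ1 : ρ < 1) (hD : 0 ≤ D)
    (hs : ∀ t ≤ T, S.iter a μs θs t ∈ Γ) (hτ : ∀ t ≤ T, S.iter a μτ θτ t ∈ Γ)
    (hstep : ∀ θ ∈ Γ, ∀ θ' ∈ Γ, ‖S.step a μτ θ - S.step a μτ θ'‖ ≤ ρ * ‖θ - θ'‖)
    (hfield : ∀ θ ∈ Γ, ‖S.field a μs θ - S.field a μτ θ‖ ≤ D) :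
    ‖S.iter a μs θs T - S.iter a μτ θτ T‖ ≤ ρ ^ T * ‖θs - θτ‖ + S.η / (1 - ρ) * D := by
  have h1ρ : 0 < 1 - ρ := sub_pos.2 hρ1
  suffices h : ∀ t ≤ T, ‖S.iter a μs θs t - S.iter a μτ θτ t‖
      ≤ ρ ^ t * ‖θs - θτ‖ + S.η / (1 - ρ) * D from h T le_rfl
  intro t
  induction t with
  | zero =>
    intro _
    have : 0 ≤ S.η / (1 - ρ) * D := by positivity
    simpa [iter] using this
  | succ t ih =>
    intro ht
    have ht' : t ≤ T := by omega
    set x := S.iter a μs θs t with hx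
    set y := S.iter a μτ θτ t with hy
    have hx1 : S.iter a μs θs (t + 1) = S.step a μs x := Function.iterate_succ_apply' _ _ _
    have hy1 : S.iter a μτ θτ (t + 1) = S.step a μτ y := Function.iterate_succ_apply' _ _ _
    -- Inserting the real-data step at `x` uses contraction of that map alone. The constant `S.η /
    -- (1 - ρ) * D` is the fixed point of `e ↦ ρ * e + S.η * D`.
    have hsplit : S.step a μs x - S.step a μτ y = (S.step a μτ x - S.step a μτ y)
        - S.η • (S.field a μs x - S.field a μτ x) := by
      simp only [step, smul_sub]
      abel
    rw [hx1, hy1, hsplit]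
    have h1 := hstep x (hs t ht') y (hτ t ht')
    have h2 : ‖S.η • (S.field a μs x - S.field a μτ x)‖ ≤ S.η * D := by
      rw [norm_smul, Real.norm_of_nonneg hη]
      exact mul_le_mul_of_nonneg_left (hfield x (hs t ht')) hη
    calc _ ≤ ρ * ‖x - y‖ + S.η * D := (norm_sub_le _ _).trans (add_le_add h1 h2)
      _ ≤ ρ * (ρ ^ t * ‖θs - θτ‖ + S.η / (1 - ρ) * D) + S.η * D := by
          gcongr
          exact ih ht'
      _ = ρ ^ (t + 1) * ‖θs - θτ‖ + S.η / (1 - ρ) * D := by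
          field_simp
          ring

/-- The update fields on two data sets differ by at most the population discrepancy and the
deviations of the two data sets from their populations. -/
theorem norm_field_sub_field_le {b : C} {μτ μs μτ' μs' : Measure Z} {θ : Param p} {κ X es eτ : ℝ}
    (hθ : θ ∈ S.feasible b) (hX0 : 0 ≤ X) (hP : ‖S.P b θ‖ ≤ κ)
    (hX : S.discrepancy b μτ μs ≤ ENNReal.ofReal X)
    (hs : ‖∫ z, S.g b θ z ∂μs' - ∫ z, S.g b θ z ∂μs‖ ≤ es)
    (hτ : ‖∫ z, S.g b θ z ∂μτ' - ∫ z, S.g b θ z ∂μτ‖ ≤ eτ) :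
    ‖S.field b μs' θ - S.field b μτ' θ‖ ≤ X + κ * (es + eτ) := by
  have hbound : ∀ v e, ‖v‖ ≤ e → ‖S.P b θ v‖ ≤ κ * e := fun v e hv =>
    (S.P b θ).le_of_opNorm_le_of_le hP hv
  have hpop : ‖S.P b θ ((∫ z, S.g b θ z ∂μτ) - ∫ z, S.g b θ z ∂μs)‖ ≤ X := by
    have := (le_iSup₂ (f := fun θ (_ : θ ∈ S.feasible b) =>
      ‖S.P b θ ((∫ z, S.g b θ z ∂μτ) - ∫ z, S.g b θ z ∂μs)‖ₑ) θ hθ).trans hX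
    rwa [← ofReal_norm, ENNReal.ofReal_le_ofReal_iff hX0] at this
  have hsplit : S.field b μs' θ - S.field b μτ' θ
      = S.P b θ (∫ z, S.g b θ z ∂μs' - ∫ z, S.g b θ z ∂μs)
        - S.P b θ (∫ z, S.g b θ z ∂μτ' - ∫ z, S.g b θ z ∂μτ)
        - S.P b θ ((∫ z, S.g b θ z ∂μτ) - ∫ z, S.g b θ z ∂μs) := by
    simp only [field, map_sub]
    abel
  rw [hsplit]
  have h1 := norm_sub_le (S.P b θ (∫ z, S.g b θ z ∂μs' - ∫ z, S.g b θ z ∂μs)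
        - S.P b θ (∫ z, S.g b θ z ∂μτ' - ∫ z, S.g b θ z ∂μτ))
        (S.P b θ ((∫ z, S.g b θ z ∂μτ) - ∫ z, S.g b θ z ∂μs))
  have h2 := norm_sub_le (S.P b θ (∫ z, S.g b θ z ∂μs' - ∫ z, S.g b θ z ∂μs))
        (S.P b θ (∫ z, S.g b θ z ∂μτ' - ∫ z, S.g b θ z ∂μτ))
  linarith [hbound _ _ hs, hbound _ _ hτ]

/-- The population risk inherits the Lipschitz bound of the empirical risks of i.i.d. samples. -/
theorem abs_risk_sub_risk_le {Ω : Type*} [MeasurableSpace Ω] {Pr : Measure Ω}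
    [IsProbabilityMeasure Pr] {Γ : Set (Param p)} {m : ℕ} (hm : 0 < m) {ν : Measure Z}
    [IsProbabilityMeasure ν] {D : Ω → Fin m → Z} (hD : Measurable D)
    (hlaw : Pr.map D = Measure.pi fun _ => ν) {B L : ℝ}
    (hmeas : ∀ θ ∈ Γ, Measurable (S.loss θ)) (hB : ∀ θ ∈ Γ, ∀ z, |S.loss θ z| ≤ B)
    (hL : ∀ᵐ ω ∂Pr, ∀ θ ∈ Γ, ∀ θ' ∈ Γ,
      |S.risk (empirical (D ω)) θ - S.risk (empirical (D ω)) θ'| ≤ L * ‖θ - θ'‖)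
    {θ θ' : Param p} (hθ : θ ∈ Γ) (hθ' : θ' ∈ Γ) :
    |S.risk ν θ - S.risk ν θ'| ≤ L * ‖θ - θ'‖ := by
  have hDj : ∀ j, MeasurePreserving (fun ω => D ω j) Pr ν := fun j =>
    (measurePreserving_eval (fun _ : Fin m => ν) j).comp ⟨hD, hlaw⟩
  have hint : ∀ θ ∈ Γ, ∀ j, Integrable (fun ω => S.loss θ (D ω j)) Pr := fun θ hθ j =>
    Integrable.of_bound ((hmeas θ hθ).comp (hDj j).measurable).aestronglyMeasurable B
      (ae_of_all _ fun ω => hB θ hθ _)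
  have hm' : (m : ℝ) ≠ 0 := by positivity
  have hemp : ∀ θ ∈ Γ, ∀ ω, S.risk (empirical (D ω)) θ = (m : ℝ)⁻¹ * ∑ j, S.loss θ (D ω j) :=
    fun θ hθ ω => integral_empirical (hmeas θ hθ).stronglyMeasurable _
  have hempint : ∀ θ ∈ Γ, Integrable (fun ω => S.risk (empirical (D ω)) θ) Pr := fun θ hθ => by
    simp_rw [hemp θ hθ]
    exact (integrable_finsetSum _ fun j _ => hint θ hθ j).const_mul _
  have hmean : ∀ θ ∈ Γ, ∫ ω, S.risk (empirical (D ω)) θ ∂Pr = S.risk ν θ := fun θ hθ => by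
    simp_rw [hemp θ hθ]
    rw [integral_const_mul, integral_finsetSum _ fun j _ => hint θ hθ j]
    have : ∀ j, ∫ ω, S.loss θ (D ω j) ∂Pr = S.risk ν θ := fun j => by
      rw [risk, ← (hDj j).map_eq, integral_map (hDj j).measurable.aemeasurable
        (hmeas θ hθ).aestronglyMeasurable]
    simp [this, hm']
  -- The almost sure Lipschitz inequality is averaged at fixed parameters. The result is
  -- deterministic, so it may later be evaluated at data-dependent endpoints.
  rw [← hmean θ hθ, ← hmean θ' hθ', ← integral_sub (hempint θ hθ) (hempint θ' hθ'),
    ← Real.norm_eq_abs]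
  refine (norm_integral_le_of_norm_le_const (C := L * ‖θ - θ'‖) ?_).trans (by simp)
  filter_upwards [hL] with ω hω using hω θ hθ θ' hθ'

/-- With probability at least `1 - exp (-L)`, the empirical means of the per-sample updates of a
configuration are uniformly close to the population means. -/
theorem exists_bad_event {Ω : Type*} [MeasurableSpace Ω] {Pr : Measure Ω} {Γ : Set (Param p)}
    {a : C} {N : ℕ} (hN : 0 < N) {μ : Measure Z} [IsProbabilityMeasure μ] {D : Ω → Fin N → Z}
    (hD : Measurable D) (hlaw : Pr.map D = Measure.pi fun _ => μ) {B R L : ℝ} (hB0 : 0 < B)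
    (hR : 0 ≤ R) (hL : 0 ≤ L) (hmeas : ∀ θ ∈ Γ, Measurable (S.g a θ))
    (hB : ∀ θ ∈ Γ, ∀ z, ‖S.g a θ z‖ ≤ B) (hsep : S.PointwiseSeparable Γ a)
    (hrad : S.rademacher Γ a μ N ≤ ENNReal.ofReal R) :
    ∃ bad : Set Ω, Pr bad ≤ ENNReal.ofReal (Real.exp (-L)) ∧ ∀ ω ∉ bad, ∀ θ ∈ Γ,
      ‖∫ z, S.g a θ z ∂(empirical (D ω)) - ∫ z, S.g a θ z ∂μ‖ ≤ R + B * √(8 * L / N) := by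
  -- Concentration is applied on the countable `Γ₀`, where the supremum is measurable; pointwise
  -- limits recover all of `Γ`.
  obtain ⟨Γ₀, hΓ₀, hcount, hdense⟩ := hsep
  have : Countable Γ₀ := hcount
  let G : Γ₀ → Z → Param p := fun θ => S.g a θ
  have hG : ∀ θ, Measurable (G θ) := fun θ => hmeas θ (hΓ₀ θ.2)
  have hGB : ∀ θ z, ‖G θ z‖ ≤ B := fun θ z => hB θ (hΓ₀ θ.2) z
  -- This choice of `s` makes the exponent `s ^ 2 * N / (8 * B ^ 2)` equal to `L`.
  have hs : 0 ≤ B * √(8 * L / N) := by positivity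
  have hradG : ∫⁻ z : Fin N → Z, (2 ^ N : ℝ≥0∞)⁻¹ * ∑ σ : Fin N → ℤˣ, signedSup G σ z
      ∂(Measure.pi fun _ => μ) ≤ ENNReal.ofReal R := by
    refine le_trans (lintegral_mono fun z => ?_) hrad
    gcongr with σ
    refine iSup_le fun θ => ?_
    exact le_iSup₂ (f := fun θ (_ : θ ∈ Γ) =>
      ‖(2 / (N : ℝ)) • ∑ i, (((σ i : ℤ) : ℝ) • S.g a θ (z i))‖ₑ) θ.1 (hΓ₀ θ.2)
  refine ⟨D ⁻¹' {z | ENNReal.ofReal (R + B * √(8 * L / N)) < uniformDeviation G μ z}, ?_, ?_⟩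
  · rw [← Measure.map_apply hD
      (measurableSet_lt measurable_const (measurable_uniformDeviation hG μ)), hlaw]
    refine (measure_uniformDeviation_gt_le hG hB0 hGB hN μ hR hs hradG).trans_eq ?_
    have hN' : (N : ℝ) ≠ 0 := by positivity
    rw [mul_pow, Real.sq_sqrt (by positivity)]
    congr 3
    field_simp
  · intro ω hω θ hθ
    obtain ⟨u, hu, hlim⟩ := hdense θ hθ
    have huB : ∀ j z, ‖S.g a (u j) z‖ ≤ B := fun j z => hB _ (hΓ₀ (hu j)) z
    have hum : ∀ j, Measurable (S.g a (u j)) := fun j => hmeas _ (hΓ₀ (hu j))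
    have hint : Tendsto (fun j => ∫ z, S.g a (u j) z ∂μ) atTop (𝓝 (∫ z, S.g a θ z ∂μ)) :=
      tendsto_integral_of_dominated_convergence (fun _ => B)
        (fun j => (hum j).aestronglyMeasurable) (integrable_const _)
        (fun j => ae_of_all _ (huB j)) (ae_of_all _ hlim)
    have hemp : Tendsto (fun j => ∫ z, S.g a (u j) z ∂(empirical (D ω))) atTop
        (𝓝 (∫ z, S.g a θ z ∂(empirical (D ω)))) := by
      rw [integral_empirical (hmeas θ hθ).stronglyMeasurable]
      simp_rw [fun j => integral_empirical (hum j).stronglyMeasurable (D ω)]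
      exact (tendsto_finsetSum _ fun i _ => hlim _).const_smul _
    refine le_of_tendsto (hemp.sub hint).norm (Eventually.of_forall fun j => ?_)
    have h1 : uniformDeviation G μ (D ω) ≤ ENNReal.ofReal (R + B * √(8 * L / N)) := not_lt.1 hω
    have h2 := (le_iSup (fun i => ‖(N : ℝ)⁻¹ • ∑ j, G i (D ω j) - ∫ y, G i y ∂μ‖ₑ)
      ⟨u j, hu j⟩).trans h1
    rw [← ofReal_norm, ENNReal.ofReal_le_ofReal_iff (by positivity)] at h2
    rwa [integral_empirical (hum j).stronglyMeasurable]

end TrainingSetup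

/-! ### Absorbing the deviations into the coverage complexity. -/

/-- Absorption of the two deviation terms into the coverage term, when the covering number is at
least `2`. -/
theorem deviation_le_coverage {R B ε H M : ℝ} {n k : ℕ} (hR : 0 ≤ R) (hB : 0 ≤ B) (hε0 : 0 < ε)
    (hε1 : ε < 1) (hk : 0 < k) (hkn : k ≤ n) (hMH : Real.log M ≤ H)
    (hH : Real.log 2 ≤ H) :
    (R / √k + B * √(8 * (Real.log M + Real.log (2 / ε)) / k))
        + (R / √n + B * √(8 * (Real.log M + Real.log (2 / ε)) / n))
      ≤ 2 * (R / √(Real.log 2) + B * √(8 * (1 + Real.log (2 / ε) / Real.log 2)))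
          * (√H / √k) := by
  have hl2 : 0 < Real.log 2 := Real.log_pos one_lt_two
  have hk' : (0 : ℝ) < k := by positivity
  have hkn' : (k : ℝ) ≤ n := by exact_mod_cast hkn
  have hlε : 0 ≤ Real.log (2 / ε) := Real.log_nonneg (by rw [le_div_iff₀ hε0]; linarith)
  have hH0 : 0 < H := hl2.trans_le hH
  set L := Real.log M + Real.log (2 / ε)
  set q := 1 + Real.log (2 / ε) / Real.log 2 with hq
  have hq0 : 0 ≤ q := by positivity
  have hLq : L ≤ q * H := by
    -- The lower bound `log 2 ≤ H` turns the confidence term into a constant multiple of `H`; below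
    -- it does the same for the Rademacher term.
    have : Real.log (2 / ε) ≤ Real.log (2 / ε) / Real.log 2 * H := by
      rw [div_mul_eq_mul_div, le_div_iff₀ hl2]
      exact mul_le_mul_of_nonneg_left hH hlε
    rw [hq, add_mul, one_mul]
    exact add_le_add hMH this
  have hone : ∀ j : ℝ, (k : ℝ) ≤ j → R / √j + B * √(8 * L / j)
      ≤ (R / √(Real.log 2) + B * √(8 * q)) * (√H / √k) := by
    intro j hj
    have h1 : R / √j ≤ R / √(Real.log 2) * (√H / √k) := by
      have : 1 ≤ √H / √(Real.log 2) := by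
        rw [one_le_div (by positivity)]
        exact Real.sqrt_le_sqrt hH
      calc R / √j ≤ R / √k := by gcongr
        _ ≤ R / √k * (√H / √(Real.log 2)) := le_mul_of_one_le_right (by positivity) this
        _ = _ := by ring
    have h2 : √(8 * L / j) ≤ √(8 * q) * (√H / √k) := by
      rw [← Real.sqrt_div' _ hk'.le, ← Real.sqrt_mul (by positivity)]
      refine Real.sqrt_le_sqrt ?_
      calc 8 * L / j ≤ 8 * (q * H) / j := by gcongr; exact hk'.le.trans hj
        _ ≤ 8 * (q * H) / k := by gcongr
        _ = _ := by ring
    calc _ ≤ R / √(Real.log 2) * (√H / √k) + B * (√(8 * q) * (√H / √k)) := by gcongr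
      _ = _ := by ring
  linarith [hone k le_rfl, hone n hkn']

/-! ### The main bound. -/

theorem theorem5p2
    (η κ ρ LR Bg Bl CG Lconf ε : ℝ)
    (hη : 0 < η) (hκ : 0 ≤ κ) (hρ0 : 0 < ρ) (hρ1 : ρ < 1) (hLR : 0 < LR) (hBg : 0 ≤ Bg)
    (hBl : 0 ≤ Bl) (hCG : 0 ≤ CG) (hLconf : 0 < Lconf) (hε0 : 0 < ε) (hε1 : ε < 1) :
    -- the constants depend on the parameters above only
    ∃ K A₁ A₂ Kcov KI : ℝ, 0 < K ∧ 0 < A₁ ∧ 0 < A₂ ∧ 0 < Kcov ∧ 0 < KI ∧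
    ∀ {C : Type u} {Z : Type v} {Ω : Type w} [MeasurableSpace C] [MeasurableSpace Z]
      [MeasurableSpace Ω] (Pr : Measure Ω) [IsProbabilityMeasure Pr] {p : ℕ}
      (S : TrainingSetup C Z p) (A : Set C) (Γ : Set (Param p)) (r : ℝ) (n k m T : ℕ)
      (θs θτ : Param p)
      (μτ μs ν : Measure Z) [IsProbabilityMeasure μτ] [IsProbabilityMeasure μs]
      [IsProbabilityMeasure ν]
      (Dτ : Ω → Fin n → Z) (Ds : Ω → Fin k → Z) (Dte : Ω → Fin m → Z),
      0 < r → 0 < k → k ≤ n → 0 < m → S.η = η →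
      -- i.i.d. real, distilled and test samples; the test sample is independent of the other two
      Measurable Dτ → Measurable Ds → Measurable Dte →
      Pr.map Dτ = Measure.pi (fun _ => μτ) →
      Pr.map Ds = Measure.pi (fun _ => μs) →
      Pr.map Dte = Measure.pi (fun _ => ν) →
      IndepFun (fun ω => (Dτ ω, Ds ω)) Dte Pr →
      -- bounded per-sample updates and preconditioners
      (∀ a ∈ A, Γ ⊆ S.feasible a) →
      (∀ a ∈ A, ∀ θ ∈ S.feasible a, Measurable (S.g a θ)) →
      (∀ a ∈ A, ∀ θ ∈ S.feasible a, ∀ z, ‖S.g a θ z‖ ≤ Bg) →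
      (∀ a ∈ A, ∀ θ ∈ S.feasible a, ‖S.P a θ‖ ≤ κ) →
      -- bounded loss, Lipschitz empirical test risk
      (∀ θ ∈ Γ, Measurable (S.loss θ)) →
      (∀ θ ∈ Γ, ∀ z, |S.loss θ z| ≤ Bl) →
      (∀ᵐ ω ∂Pr, ∀ θ ∈ Γ, ∀ θ' ∈ Γ,
        |S.risk (empirical (Dte ω)) θ - S.risk (empirical (Dte ω)) θ'| ≤ LR * ‖θ - θ'‖) →
      -- the trajectories stay in `Γ`, on which the update maps contract
      (∀ᵐ ω ∂Pr, ∀ a ∈ A, ∀ t ≤ T,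
        S.iter a (empirical (Ds ω)) θs t ∈ Γ ∧ S.iter a (empirical (Dτ ω)) θτ t ∈ Γ) →
      (∀ᵐ ω ∂Pr, ∀ a ∈ A, ∀ μ ∈ ({empirical (Dτ ω), empirical (Ds ω)} : Set (Measure Z)),
        ∀ θ ∈ Γ, ∀ θ' ∈ Γ, ‖S.step a μ θ - S.step a μ θ'‖ ≤ ρ * ‖θ - θ'‖) →
      -- Rademacher rates
      (∀ a ∈ A, S.PointwiseSeparable Γ a) →
      (∀ a ∈ A, S.rademacher Γ a μs k ≤ ENNReal.ofReal (CG / √k)) →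
      (∀ a ∈ A, S.rademacher Γ a μτ n ≤ ENNReal.ofReal (CG / √n)) →
      -- the family has finite covering number for its configuration distance
      (∀ᵐ ω ∂Pr, coveringNumber A (S.configDist (empirical (Dτ ω))) r ≠ ⊤) →
      -- Lipschitz transfer across configurations: the distance built from one draw `ω` of the real
      -- data controls the update fields on the real and the distilled data of every draw `ω'`
      (∀ᵐ ω ∂Pr, ∀ᵐ ω' ∂Pr, ∀ a ∈ A, ∀ a' ∈ A,
        ∀ μ ∈ ({empirical (Dτ ω'), empirical (Ds ω')} : Set (Measure Z)), ∀ θ ∈ Γ,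
        ‖S.field a μ θ - S.field a' μ θ‖ₑ
          ≤ ENNReal.ofReal Lconf * S.configDist (empirical (Dτ ω)) a a') →
      let N : Ω → ℕ∞ := fun ω => coveringNumber A (S.configDist (empirical (Dτ ω))) r
      let H : Ω → ℝ := fun ω => S.Hcov A (empirical (Dτ ω)) r
      let gap : Ω → C → ℝ≥0∞ := fun ω a =>
        ENNReal.ofReal (S.riskGap ν (empirical (Ds ω)) (empirical (Dτ ω)) θs θτ T a)
      let εbound : Ω → ℝ≥0∞ := fun ω => ENNReal.ofReal K *
        (ENNReal.ofReal (ρ ^ T * ‖θs - θτ‖)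
          + (⨆ a ∈ A, S.intrinsicError a μτ k) + S.matchingExcess A μτ μs k
          + ENNReal.ofReal (1 / √n) + ENNReal.ofReal (√(H ω) / √m) + ENNReal.ofReal r)
      -- both bounds, with an additional term `c`, at the outcome `ω`
      let Bounds : ℝ≥0∞ → Ω → Prop := fun c ω =>
        (∀ prior : Measure C, IsProbabilityMeasure prior → (∀ᵐ a ∂prior, a ∈ A) →
          ∫⁻ a, gap ω a ∂prior
            ≤ εbound ω + ENNReal.ofReal (A₁ * (H ω / k) + A₂ * √(H ω / k)) + c) ∧
        (⨆ a ∈ A, gap ω a) ≤ εbound ω + ENNReal.ofReal (Kcov * √(H ω) / √k) + c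
      (IndepFun Ds Dτ Pr → Pr {ω | ¬ (2 ≤ N ω → Bounds 0 ω)} ≤ ENNReal.ofReal ε) ∧
      Pr {ω | ¬ (2 ≤ N ω →
          Bounds (ENNReal.ofReal KI * (mutualInformation Ds Dτ Pr / k) ^ (1 / 2 : ℝ)) ω)}
        ≤ ENNReal.ofReal ε := by
  set c₀ : ℝ := LR * (η / (1 - ρ)) with hc₀
  set Q : ℝ := CG / √(Real.log 2) + (Bg + 1) * √(8 * (1 + Real.log (2 / ε) / Real.log 2)) with hQ
  have h1ρ : 0 < 1 - ρ := sub_pos.2 hρ1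
  have hl2 : 0 < Real.log 2 := Real.log_pos one_lt_two
  have hlε : 0 ≤ Real.log (2 / ε) := Real.log_nonneg (by rw [le_div_iff₀ hε0]; linarith)
  have hc₀pos : 0 < c₀ := by positivity
  have hQ0 : 0 ≤ Q := by positivity
  -- In `K`, `LR` pays for the initial distance, `2 * c₀ * Lconf` for passing to the cover on both
  -- data sets, and `c₀` for the discrepancy. The `+ 1` in `A₂` and `Kcov` keeps them positive if `κ
  -- * Q` vanishes; `A₁` and `KI` multiply nonnegative slack.
  refine ⟨LR + c₀ * (2 * Lconf + 1), 1, c₀ * (κ * (2 * Q)) + 1, c₀ * (κ * (2 * Q)) + 1, 1,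
    by positivity, one_pos, by positivity, by positivity, one_pos, ?_⟩
  intro C Z Ω _ _ _ Pr _ p S A Γ r n k m T θs θτ μτ μs ν _ _ _ Dτ Ds Dte hr hk hkn hm hSη hDτ hDs
    hDte hlawτ hlaws hlawte _ hΓ hgm hgB hP hlm hlB hlL htraj hcontr hsep hrads hradτ hfin htrans
    N H gap εbound Bounds
  have hn : 0 < n := hk.trans_le hkn
  have hriskL := fun θ (hθ : θ ∈ Γ) θ' (hθ' : θ' ∈ Γ) =>
    S.abs_risk_sub_risk_le hm hDte hlawte hlm hlB hlL hθ hθ'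
  -- a cover that does not depend on the outcome, of minimal size over the typical outcomes
  obtain ⟨F, hFA, hFcover, hFcard⟩ : ∃ F : Finset C, (F : Set C) ⊆ A ∧
      (∀ᵐ ω ∂Pr, ∀ a ∈ A, ∃ b ∈ F, ∀ θ ∈ Γ,
        ‖S.field a (empirical (Ds ω)) θ - S.field b (empirical (Ds ω)) θ‖ ≤ Lconf * r ∧
        ‖S.field a (empirical (Dτ ω)) θ - S.field b (empirical (Dτ ω)) θ‖ ≤ Lconf * r) ∧
      ∀ᵐ ω ∂Pr, (F.card : ℕ∞) ≤ N ω := by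
    have hgood := hfin.and htrans
    -- Well-foundedness of `ℕ∞` gives a typical outcome of minimal covering number. Its cover is
    -- deterministic, yet no larger than the covering number of almost every outcome.
    obtain ⟨ω₀, hω₀, hmin⟩ := exists_minimalFor_of_wellFoundedLT _ N hgood.exists
    obtain ⟨F, hFA, hF, hcard⟩ := exists_cover_of_coveringNumber_ne_top hω₀.1
    refine ⟨F, hFA, ?_, ?_⟩
    · filter_upwards [hω₀.2] with ω hω a ha
      obtain ⟨b, hb, hab⟩ := hF a ha
      refine ⟨b, hb, fun θ hθ => ?_⟩
      have key : ∀ μ ∈ ({empirical (Dτ ω), empirical (Ds ω)} : Set (Measure Z)),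
          ‖S.field a μ θ - S.field b μ θ‖ ≤ Lconf * r := fun μ hμ => by
        have := (hω a ha b (hFA hb) μ hμ θ hθ).trans (mul_le_mul_right hab _)
        rwa [← ENNReal.ofReal_mul hLconf.le, ← ofReal_norm,
          ENNReal.ofReal_le_ofReal_iff (by positivity)] at this
      exact ⟨key _ (by simp), key _ (by simp)⟩
    · filter_upwards [hgood] with ω hω
      exact hcard.trans ((le_total (N ω) (N ω₀)).elim (fun h => hmin hω h) id)
  -- The floor `2` keeps `log M` nonnegative when `F` is small, and still gives `log M ≤ H ω` when
  -- `N ω ≥ 2`.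
  set M : ℝ := max F.card 2
  have hM2 : 2 ≤ M := le_max_right _ _
  have hM0 : 0 < M := two_pos.trans_le hM2
  set L : ℝ := Real.log M + Real.log (2 / ε) with hLdef
  have hL0 : 0 ≤ L := add_nonneg (Real.log_nonneg (by linarith)) hlε
  -- the exceptional event
  have hbads := fun b (hb : b ∈ F) => S.exists_bad_event (Γ := Γ) (a := b) hk hDs hlaws
    (B := Bg + 1) (R := CG / √k) (L := L) (by positivity) (by positivity) hL0
    (fun θ hθ => hgm b (hFA hb) θ (hΓ b (hFA hb) hθ))
    (fun θ hθ z => (hgB b (hFA hb) θ (hΓ b (hFA hb) hθ) z).trans (by linarith))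
    (hsep b (hFA hb)) (hrads b (hFA hb))
  have hbadτ := fun b (hb : b ∈ F) => S.exists_bad_event (Γ := Γ) (a := b) hn hDτ hlawτ
    (B := Bg + 1) (R := CG / √n) (L := L) (by positivity) (by positivity) hL0
    (fun θ hθ => hgm b (hFA hb) θ (hΓ b (hFA hb) hθ))
    (fun θ hθ z => (hgB b (hFA hb) θ (hΓ b (hFA hb) hθ) z).trans (by linarith))
    (hsep b (hFA hb)) (hradτ b (hFA hb))
  choose! bads hbads_le hbads_dev using hbads
  choose! badτ hbadτ_le hbadτ_dev using hbadτ
  -- Each element of `F` has two bad events, one per sample, and `F.card ≤ M`.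
  have hexp : Real.exp (-L) = ε / (2 * M) := by
    rw [hLdef, ← Real.log_mul hM0.ne' (by positivity), Real.exp_neg,
      Real.exp_log (by positivity)]
    field_simp
  have hunion : Pr (⋃ b ∈ F, (bads b ∪ badτ b)) ≤ ENNReal.ofReal ε := by
    calc Pr (⋃ b ∈ F, (bads b ∪ badτ b)) ≤ ∑ b ∈ F, Pr (bads b ∪ badτ b) :=
          measure_biUnion_finset_le _ _
      _ ≤ ∑ b ∈ F, ENNReal.ofReal (ε / M) := by
          refine Finset.sum_le_sum fun b hb => (measure_union_le _ _).trans
            ((add_le_add (hbads_le b hb) (hbadτ_le b hb)).trans_eq ?_)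
          rw [hexp, ← ENNReal.ofReal_add (by positivity) (by positivity)]
          congr 1
          field_simp
          norm_num
      _ = ENNReal.ofReal (F.card * (ε / M)) := by
          rw [Finset.sum_const, nsmul_eq_mul, ENNReal.ofReal_mul (by positivity),
            ENNReal.ofReal_natCast]
      _ ≤ ENNReal.ofReal ε := by
          refine ENNReal.ofReal_le_ofReal ?_
          rw [mul_div_assoc', div_le_iff₀ hM0, mul_comm]
          exact mul_le_mul_of_nonneg_left (le_max_left _ _) hε0.le
  -- the bound for a single configuration outside the exceptional event
  have hmain : ∀ᵐ ω ∂Pr, ω ∉ (⋃ b ∈ F, (bads b ∪ badτ b)) → 2 ≤ N ω → ∀ a ∈ A,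
      gap ω a ≤ εbound ω + ENNReal.ofReal ((c₀ * (κ * (2 * Q)) + 1) * √(H ω) / √k) := by
    filter_upwards [htraj, hcontr, hfin, hFcover, hFcard] with ω htraj hcontr hfin hcover hcard
      hω hN2 a ha
    set X := (⨆ a ∈ A, S.intrinsicError a μτ k) + S.matchingExcess A μτ μs k with hX
    have hεb : εbound ω = ENNReal.ofReal (LR + c₀ * (2 * Lconf + 1)) *
        (ENNReal.ofReal (ρ ^ T * ‖θs - θτ‖) + X + ENNReal.ofReal (1 / √n)
          + ENNReal.ofReal (√(H ω) / √m) + ENNReal.ofReal r) := by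
      simp only [εbound, hX, add_assoc]
    have hK0 : 0 < LR + c₀ * (2 * Lconf + 1) := by positivity
    -- An infinite discrepancy term makes the bound trivial; otherwise the estimate takes place in
    -- `ℝ`.
    by_cases hXtop : X = ⊤
    · rw [hεb, hXtop]
      simp [ENNReal.mul_top, hK0]
    obtain ⟨x, hx0, hxX⟩ : ∃ x : ℝ, 0 ≤ x ∧ X = ENNReal.ofReal x :=
      ⟨X.toReal, ENNReal.toReal_nonneg, (ENNReal.ofReal_toReal hXtop).symm⟩
    -- the covering number as a real number
    obtain ⟨j, hj⟩ := ENat.ne_top_iff_exists.1 hfin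
    have hNj : N ω = j := hj.symm
    have hHj : H ω = Real.log j := by
      simp only [H, TrainingSetup.Hcov, ← hj, ENat.toNat_natCast]
    rw [hNj] at hN2 hcard
    have hj2 : (2 : ℝ) ≤ j := by exact_mod_cast hN2
    have hFj : (F.card : ℝ) ≤ j := by exact_mod_cast hcard
    have hMH : Real.log M ≤ H ω := by
      rw [hHj]
      exact Real.log_le_log hM0 (max_le hFj hj2)
    have hH2 : Real.log 2 ≤ H ω := by
      rw [hHj]
      exact Real.log_le_log two_pos hj2
    have hdev := deviation_le_coverage hCG (by linarith : 0 ≤ Bg + 1) hε0 hε1 hk hkn hMH hH2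
    rw [← hLdef, ← hQ] at hdev
    obtain ⟨b, hb, hab⟩ := hcover a ha
    have hωb : ω ∉ bads b ∧ ω ∉ badτ b := by
      simp only [Set.mem_iUnion, Set.mem_union, not_exists, not_or] at hω
      exact hω b hb
    have hfield : ∀ θ ∈ Γ, ‖S.field a (empirical (Ds ω)) θ - S.field a (empirical (Dτ ω)) θ‖
        ≤ 2 * (Lconf * r) + (x + κ * (2 * Q * (√(H ω) / √k))) := by
      intro θ hθ
      have hθb := hΓ b (hFA hb) hθ
      have h1 := S.norm_field_sub_field_le hθb hx0 (hP b (hFA hb) θ hθb)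
        ((S.discrepancy_le_intrinsicError_add_matchingExcess (hFA hb) μτ μs k).trans_eq hxX)
        (hbads_dev b hb ω hωb.1 θ hθ) (hbadτ_dev b hb ω hωb.2 θ hθ)
      have h2 := h1.trans (by gcongr : _ ≤ x + κ * (2 * Q * (√(H ω) / √k)))
      have h3 := hab θ hθ
      have h4 := dist_triangle4 (S.field a (empirical (Ds ω)) θ) (S.field b (empirical (Ds ω)) θ)
        (S.field b (empirical (Dτ ω)) θ) (S.field a (empirical (Dτ ω)) θ)
      rw [dist_comm (S.field b (empirical (Dτ ω)) θ)] at h4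
      simp only [dist_eq_norm] at h4
      linarith [h3.1, h3.2]
    have hiter := S.norm_iter_sub_iter_le (hSη ▸ hη.le) hρ0 hρ1 (by positivity)
      (fun t ht => (htraj a ha t ht).1) (fun t ht => (htraj a ha t ht).2)
      (hcontr a ha _ (by simp)) hfield
    have hgap := (hriskL _ (htraj a ha T le_rfl).1 _ (htraj a ha T le_rfl).2).trans
      (mul_le_mul_of_nonneg_left hiter hLR.le)
    rw [hSη] at hgap
    rw [hεb, hxX]
    have hd : 0 ≤ ρ ^ T * ‖θs - θτ‖ := by positivity
    rw [← ENNReal.ofReal_add (by positivity) hx0, ← ENNReal.ofReal_add (by positivity)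
      (by positivity), ← ENNReal.ofReal_add (by positivity) (by positivity),
      ← ENNReal.ofReal_add (by positivity) hr.le, ← ENNReal.ofReal_mul hK0.le,
      ← ENNReal.ofReal_add (by positivity) (by positivity)]
    refine ENNReal.ofReal_le_ofReal (hgap.trans ?_)
    have e1 : LR * (ρ ^ T * ‖θs - θτ‖ + η / (1 - ρ) *
          (2 * (Lconf * r) + (x + κ * (2 * Q * (√(H ω) / √k)))))
        = LR * (ρ ^ T * ‖θs - θτ‖) + c₀ * (2 * Lconf) * r + c₀ * x
          + c₀ * (κ * (2 * Q)) * √(H ω) / √k := by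
      rw [hc₀]
      ring
    rw [e1, add_mul _ (1 : ℝ), one_mul, add_div]
    refine add_le_add ?_ (le_add_of_nonneg_right (by positivity))
    -- These two summands serve only as slack: the real-data deviation was absorbed through `k ≤ n`,
    -- and the risk compared is already the population risk.
    have hn0 : 0 ≤ 1 / √(n : ℝ) := by positivity
    have hm0 : 0 ≤ √(H ω) / √(m : ℝ) := by positivity
    have hLc : 0 ≤ c₀ * (2 * Lconf) := by positivity
    calc _ ≤ (LR + c₀ * (2 * Lconf + 1)) * (ρ ^ T * ‖θs - θτ‖)
          + (LR + c₀ * (2 * Lconf + 1)) * r + (LR + c₀ * (2 * Lconf + 1)) * x := by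
          gcongr <;> linarith
      _ = (LR + c₀ * (2 * Lconf + 1)) * (ρ ^ T * ‖θs - θτ‖ + x + r) := by ring
      _ ≤ _ := mul_le_mul_of_nonneg_left (by linarith) hK0.le
  -- The extra term `c` only enlarges the right-hand sides, so both couplings follow from the
  -- estimate without it.
  have hbounds : ∀ c, Pr {ω | ¬ (2 ≤ N ω → Bounds c ω)} ≤ ENNReal.ofReal ε := by
    intro c
    refine le_trans (measure_mono_ae ?_) hunion
    filter_upwards [hmain] with ω hω hbad
    by_contra hnot
    refine hbad fun hN2 => ?_
    have hgap := hω hnot hN2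
    have hH0 : 0 ≤ H ω := Real.log_natCast_nonneg _
    refine ⟨fun prior _ hprior => ?_, (iSup₂_le hgap).trans le_self_add⟩
    calc ∫⁻ a, gap ω a ∂prior
        ≤ ∫⁻ _, (εbound ω + ENNReal.ofReal ((c₀ * (κ * (2 * Q)) + 1) * √(H ω) / √k)) ∂prior :=
          lintegral_mono_ae (by filter_upwards [hprior] with a ha using hgap a ha)
      _ = εbound ω + ENNReal.ofReal ((c₀ * (κ * (2 * Q)) + 1) * √(H ω) / √k) := by simp
      _ ≤ εbound ω
          + ENNReal.ofReal (1 * (H ω / k) + (c₀ * (κ * (2 * Q)) + 1) * √(H ω / k)) := by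
          gcongr
          rw [Real.sqrt_div' _ (by positivity), mul_div_assoc]
          exact le_add_of_nonneg_left (by positivity)
      _ ≤ _ := le_self_add
  exact ⟨fun _ => hbounds _, hbounds _⟩
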